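/- Let $G$ be a connected (simple, not necessarily countable) graph. A \emph{direction} of $G$ is a map $f$ that assigns to every finite set $X\subseteq V(G)$ a component $f(X)$ of $G-X$ such that $f(X)\supseteq f(X')$ whenever $X\subseteq X'$. A \emph{directional choice} in $G$ is a pair $(X,C)$ of a finite set $X\subseteq V(G)$ and a component $C$ of $G-X$; it \emph{distinguishes} a direction $f$ from a direction $h$ if $f(X)=C$ and $h(X)\neq C$. The graph $G$ is \emph{countably determined} if there is a countable set $D$ of directional choices in $G$ that distinguish every two directions of $G$ from each other: for all directions $f\neq h$ of $G$ some element of $D$ distinguishes $f$ from $h$ (and, exchanging roles, some element distinguishes $h$ from $f$). Two rays (one-way infinite paths) in $G$ are \emph{equivalent} if no finite set of vertices separates them in $G$; the \emph{ends} of $G$ are the equivalence classes of rays. The \emph{tree-order} of a tree $T$ with root $r$ is given by $u\leq v$ if $u$ lies on the path from $r$ to $v$ in $T$. A rooted tree $T\subseteq G$ is \emph{normal} in $G$ if the endvertices of every non-trivial path in $G$ that meets $T$ exactly in its endvertices are comparable in the tree-order of $T$. Then the following assertions are equivalent: \begin{enumerate} \item[(i)] $G$ is countably determined; \item[(i$'$)]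 there is a countable set $D$ of directional choices in $G$ such that for all directions $f\neq h$ of $G$ some element of $D$ distinguishes $f$ from $h$ or $h$ from $f$; \item[(ii)] $G$ contains a countable (possibly finite) normal tree that contains a ray from every end of $G$. \end{enumerate} -/

import Mathlib

namespace SimpleGraph

variable {V : Type*}

/-! ### Directions -/

/-- A direction of `G`: a map `f` that assigns to every finite vertex set `X` a component `f X`
of `G - X` such that `f X ⊇ f Y` whenever `X ⊆ Y`. -/
structure Direction (G : SimpleGraph V) where
  /-- The chosen component of `G - X`. -/
  toFun : (X : Finset V) → G.ComponentCompl (X : Set V)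
  anti : ∀ ⦃X Y : Finset V⦄, X ⊆ Y → (toFun Y : Set V) ⊆ (toFun X : Set V)

/-- A directional choice in `G`: a pair `(X, C)` of a finite vertex set `X` and a component `C` of
`G - X`. -/
abbrev DirectionalChoice (G : SimpleGraph V) : Type _ :=
  Σ X : Finset V, G.ComponentCompl (X : Set V)

/-- The directional choice `(X, C)` distinguishes the direction `f` from the direction `h`. -/
def DirectionalChoice.Distinguishes {G : SimpleGraph V} (c : G.DirectionalChoice)
    (f h : G.Direction) : Prop :=
  f.toFun c.1 = c.2 ∧ h.toFun c.1 ≠ c.2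

/-- `G` is countably determined: there is a countable set of directional choices that distinguish
every two directions from each other, i.e. each of the two from the other one (the pair `(f, h)`
below is ordered). -/
def IsCountablyDetermined (G : SimpleGraph V) : Prop :=
  ∃ D : Set G.DirectionalChoice, D.Countable ∧
    ∀ f h : G.Direction, f ≠ h → ∃ c ∈ D, c.Distinguishes f h

/-- The formally weaker condition in which, of every two directions, only one has to be
distinguished from the other. -/
def IsWeaklyCountablyDetermined (G : SimpleGraph V) : Prop :=
  ∃ D : Set G.DirectionalChoice, D.Countable ∧
    ∀ f h : G.Direction, f ≠ h → ∃ c ∈ D, c.Distinguishes f h ∨ c.Distinguishes h f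

/-! ### Rays and ends -/

/-- A ray of `G`: a one-way infinite path, with its vertices listed in order. -/
structure Ray (G : SimpleGraph V) where
  /-- The sequence of vertices. -/
  toFun : ℕ → V
  injective : Function.Injective toFun
  adj : ∀ n, G.Adj (toFun n) (toFun (n + 1))

namespace Ray

variable {G : SimpleGraph V}

/-- The vertex set `X` separates the rays `R` and `S`: it meets every walk from a vertex
of `R` to a vertex of `S` (equivalently, every such path). -/
def SeparatedBy (R S : G.Ray) (X : Finset V) : Prop :=
  ∀ (i j : ℕ) (p : G.Walk (R.toFun i) (S.toFun j)), ∃ x ∈ p.support, x ∈ X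

/-- Two rays are equivalent if no finite set of vertices separates them. -/
def Equivalent (R S : G.Ray) : Prop :=
  ∀ X : Finset V, ¬ R.SeparatedBy S X

theorem exists_tail (R : G.Ray) (X : Finset V) : ∃ n, ∀ i, n ≤ i → R.toFun i ∉ X := by
  have h := R.injective.tendsto_cofinite.eventually X.finite_toSet.compl_mem_cofinite
  rw [Nat.cofinite_eq_atTop] at h
  obtain ⟨n, hn⟩ := Filter.eventually_atTop.1 h
  exact ⟨n, fun i hi => by simpa using hn i hi⟩

theorem exists_walk_tail (R : G.Ray) (X : Finset V) (n : ℕ) (hn : ∀ i, n ≤ i → R.toFun i ∉ X)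
    {i j : ℕ} (hi : n ≤ i) (hj : n ≤ j) :
    ∃ p : G.Walk (R.toFun i) (R.toFun j), ∀ x ∈ p.support, x ∉ X := by
  have key : ∀ k, n ≤ k →
      ∃ p : G.Walk (R.toFun n) (R.toFun k), ∀ x ∈ p.support, x ∉ X := by
    intro k hk
    induction k, hk using Nat.le_induction with
    | base => exact ⟨Walk.nil, by simpa using hn n le_rfl⟩
    | succ k hk ih =>
      obtain ⟨p, hp⟩ := ih
      refine ⟨p.concat (R.adj k), fun x hx => ?_⟩
      rw [Walk.support_concat, List.mem_append, List.mem_singleton] at hx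
      rcases hx with hx | rfl
      · exact hp x hx
      · exact hn _ (by omega)
  obtain ⟨p, hp⟩ := key i hi
  obtain ⟨q, hq⟩ := key j hj
  refine ⟨p.reverse.append q, fun x hx => ?_⟩
  rcases Walk.mem_support_append_iff _ _ |>.1 hx with hx | hx
  · exact hp x (by simpa using hx)
  · exact hq x hx

theorem Equivalent.refl (R : G.Ray) : R.Equivalent R := by
  intro X h
  obtain ⟨n, hn⟩ := R.exists_tail X
  obtain ⟨x, hx, hxX⟩ := h n n Walk.nil
  rw [Walk.support_nil, List.mem_singleton] at hx
  exact hn n le_rfl (hx ▸ hxX)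

theorem Equivalent.symm {R S : G.Ray} (h : R.Equivalent S) : S.Equivalent R := by
  intro X hX
  refine h X fun i j p => ?_
  obtain ⟨x, hx, hxX⟩ := hX j i p.reverse
  exact ⟨x, by simpa using hx, hxX⟩

theorem Equivalent.trans {R S T : G.Ray} (h : R.Equivalent S) (h' : S.Equivalent T) :
    R.Equivalent T := by
  classical
  intro X hX
  obtain ⟨n, hn⟩ := S.exists_tail X
  have hlt : ∀ j, S.toFun j ∉ X ∪ (Finset.range n).image S.toFun → n ≤ j := by
    intro j hj
    by_contra hlt
    exact hj (Finset.mem_union_right _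
      (Finset.mem_image_of_mem _ (Finset.mem_range.2 (not_le.1 hlt))))
  have h1 := h (X ∪ (Finset.range n).image S.toFun)
  have h2 := h' (X ∪ (Finset.range n).image S.toFun)
  simp only [SeparatedBy, not_forall, not_exists, not_and] at h1 h2
  obtain ⟨i, j, p, hp⟩ := h1
  obtain ⟨k, l, q, hq⟩ := h2
  obtain ⟨s, hs⟩ := S.exists_walk_tail X n hn (hlt j (hp _ p.end_mem_support))
    (hlt k (hq _ q.start_mem_support))
  obtain ⟨x, hx, hxX⟩ := hX i l ((p.append s).append q)
  rcases Walk.mem_support_append_iff _ _ |>.1 hx with hx | hx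
  · rcases Walk.mem_support_append_iff _ _ |>.1 hx with hx | hx
    · exact hp x hx (Finset.mem_union_left _ hxX)
    · exact hs x hx hxX
  · exact hq x hx (Finset.mem_union_left _ hxX)

/-- Equivalence of rays as a setoid. -/
def setoid (G : SimpleGraph V) : Setoid G.Ray where
  r := Equivalent
  iseqv := ⟨Equivalent.refl, Equivalent.symm, Equivalent.trans⟩

/-- The ray `R` of `G` is contained in the subgraph `T` of `G`. -/
def IsContainedIn (R : G.Ray) (T : G.Subgraph) : Prop :=
  ∀ n, T.Adj (R.toFun n) (R.toFun (n + 1))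

end Ray

/-- The ends of `G`: the equivalence classes of its rays. -/
def RayEnd (G : SimpleGraph V) : Type _ :=
  Quotient (Ray.setoid G)

/-- The end of `G` that contains the ray `R`. -/
def Ray.toEnd {G : SimpleGraph V} (R : G.Ray) : G.RayEnd :=
  Quotient.mk (Ray.setoid G) R

/-! ### Normal trees -/

/-- The tree-order of the tree `T` with root `r`: `u ≤ v` if `u` lies on the (unique) path from `r`
to `v` in `T`. -/
def TreeLE {W : Type*} (T : SimpleGraph W) (r u v : W) : Prop :=
  ∃ p : T.Walk r v, p.IsPath ∧ u ∈ p.support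

/-- The walk `p` is an `H`-path in `G`: a non-trivial path that meets `H` exactly in its
endvertices. -/
def Subgraph.IsSubgraphPath {G : SimpleGraph V} (H : G.Subgraph) {u v : V} (p : G.Walk u v) :
    Prop :=
  p.IsPath ∧ 0 < p.length ∧ ∀ x ∈ p.support, x ∈ H.verts ↔ x = u ∨ x = v

/-- The subgraph `T` of `G`, rooted at its vertex `r`, is a normal tree in `G`: it is a tree, and
the endvertices of every `T`-path in `G` are comparable in the tree-order of `T`. -/
def Subgraph.IsNormalTree {G : SimpleGraph V} (T : G.Subgraph) (r : T.verts) : Prop :=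
  T.coe.IsTree ∧ ∀ (u v : T.verts) (p : G.Walk (u : V) (v : V)), T.IsSubgraphPath p →
    T.coe.TreeLE r u v ∨ T.coe.TreeLE r v u

end SimpleGraph

namespace SimpleGraph

variable {V : Type*} {G : SimpleGraph V}

/-! ### Walks and components -/

/-! A normal tree `T` reflects the connectivity of `G`: if `A` is closed downwards in `T`, tree
vertices in one component of `G - A` are joined in `T - A` (`exists_isPath_avoiding`).

Suppose `T` is countable and contains a ray from every end. Every component chosen by a direction
contains a ray, so it meets `T`. Hence distinct directions already differ on a finite subset of `T`
(`exists_toFun_ne`), and the countably many choices `(A, C)` with `A ⊆ T` and `C` meeting `T`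
suffice.

Conversely, let `S` be the union of the sets `X` over all choices `(X, C)` in `D`. A direction is
determined by its values on finite subsets of `S`. Enclose `S` in a countable normal tree `T`. A
direction whose components for finite `A ⊆ T` all meet `T` is the direction of a ray of `T`
(`Subgraph.IsNormalTree.exists_ray`). Any other direction chooses, for some finite `N ⊆ T`, a
component that avoids `T` and has neighbourhood `N`. The crux is that each `N` admits only countably
many of these (`countable_directionsAvoiding`): a choice in `D` can tell two of them apart only if
its component is one of theirs. Adding a ray for each exceptional direction yields a countable set
that meets every chosen component, and a second normal tree around this set contains a ray in every
direction, hence from every end. -/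

theorem ComponentCompl.mem_of_walk {K : Set V} {C : G.ComponentCompl K} {v w : V} (hv : v ∈ C)
    (p : G.Walk v w) (hp : ∀ z ∈ p.support, z ∉ K) : w ∈ C := by
  induction p with
  | nil => exact hv
  | cons h p ih =>
    refine ih (ComponentCompl.mem_of_adj _ _ hv (hp _ (by simp)) h) fun z hz => hp z ?_
    simp [hz]

theorem ComponentCompl.exists_walk {K : Set V} {C : G.ComponentCompl K} {v w : V} (hv : v ∈ C)
    (hw : w ∈ C) : ∃ p : G.Walk v w, ∀ z ∈ p.support, z ∉ K := by
  obtain ⟨hvK, rfl⟩ := hv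
  obtain ⟨hwK, h⟩ := hw
  obtain ⟨p⟩ := ConnectedComponent.exact h.symm
  refine ⟨p.map (Embedding.induce Kᶜ).toHom, fun z hz => ?_⟩
  obtain ⟨⟨y, hy⟩, -, rfl⟩ := List.mem_map.1 (Walk.support_map _ p ▸ hz)
  exact hy

theorem ComponentCompl.eq_of_mem {K : Set V} {C D : G.ComponentCompl K} {v : V} (hC : v ∈ C)
    (hD : v ∈ D) : C = D :=
  hC.choose_spec.symm.trans hD.choose_spec

/-- A component of `G - K` that meets a component `D` of `G - L` and avoids `L` lies in `D`. -/
theorem ComponentCompl.subset_of_disjoint {K L : Set V} {C : G.ComponentCompl K}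
    {D : G.ComponentCompl L} {v : V} (hC : v ∈ C) (hD : v ∈ D) (h : ∀ z ∈ C, z ∉ L) :
    (C : Set V) ⊆ D := by
  classical
  intro w hw
  obtain ⟨p, hp⟩ := exists_walk hC hw
  refine mem_of_walk hD p fun z hz => h z (mem_of_walk hC (p.takeUntil z hz) fun y hy => ?_)
  exact hp y (p.support_takeUntil_subset_support hz hy)

/-! ### Directions and the rays in their components -/

namespace Direction

theorem toFun_injective : Function.Injective (toFun : G.Direction → _) := by
  rintro ⟨f, hf⟩ ⟨h, hh⟩ rfl
  rfl

theorem exists_mem (f : G.Direction) (X : Finset V) : ∃ v, v ∈ f.toFun X :=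
  (f.toFun X).nonempty

theorem toFun_eq_of_subset {f h : G.Direction} {X Y : Finset V} (hXY : X ⊆ Y)
    (he : f.toFun Y = h.toFun Y) : f.toFun X = h.toFun X := by
  obtain ⟨v, hv⟩ := f.exists_mem Y
  exact ComponentCompl.eq_of_mem (f.anti hXY hv) (h.anti hXY (he ▸ hv))

/-- If `f X` avoids the finite set `Y`, then `f X ⊆ f Y`. -/
theorem subset_of_disjoint (f : G.Direction) {X Y : Finset V} (h : ∀ z ∈ f.toFun X, z ∉ Y) :
    (f.toFun X : Set V) ⊆ f.toFun Y := by
  classical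
  obtain ⟨v, hv⟩ := f.exists_mem (X ∪ Y)
  exact ComponentCompl.subset_of_disjoint (f.anti Finset.subset_union_left hv)
    (f.anti Finset.subset_union_right hv) (fun z hz => by simpa using h z hz)

theorem exists_adj [DecidableEq V] (f : G.Direction) {A : Finset V} {v : V} (hv : v ∈ f.toFun A) :
    ∃ w ∈ f.toFun (insert v A), G.Adj v w := by
  obtain ⟨z, hz⟩ := f.exists_mem (insert v A)
  obtain ⟨p, hp⟩ := ComponentCompl.exists_walk hv (f.anti (Finset.subset_insert v A) hz)
  have hq := p.bypass_isPath
  have hqp := p.support_bypass_subset_support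
  generalize p.bypass = q at hq hqp
  cases q with
  | nil => exact absurd (Finset.mem_insert_self v A) (ComponentCompl.notMem_of_mem hz)
  | cons h q =>
    rw [Walk.cons_isPath_iff] at hq
    refine ⟨_, ComponentCompl.mem_of_walk hz q.reverse fun y hy => ?_, h⟩
    rw [Walk.support_reverse, List.mem_reverse] at hy
    have h1 := hp y (hqp (by simp [hy]))
    rw [Finset.mem_coe] at h1
    rw [Finset.mem_coe, Finset.mem_insert, not_or]
    exact ⟨fun e => hq.2 (e ▸ hy), h1⟩

/-- Every component chosen by a direction contains a ray. -/
theorem exists_ray (f : G.Direction) (X : Finset V) :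
    ∃ R : G.Ray, ∀ n, R.toFun n ∈ f.toFun X := by
  classical
  -- In a state `(A, v)`, the set `A` consists of `X` and the vertices already visited, so each new
  -- vertex in `f A` is automatically distinct from them.
  have step : ∀ s : {s : Finset V × V // X ⊆ s.1 ∧ s.2 ∈ f.toFun s.1},
      ∃ s' : {s : Finset V × V // X ⊆ s.1 ∧ s.2 ∈ f.toFun s.1},
        s'.1.1 = insert s.1.2 s.1.1 ∧ G.Adj s.1.2 s'.1.2 := by
    rintro ⟨⟨A, v⟩, hA, hv⟩
    obtain ⟨w, hw, hadj⟩ := f.exists_adj hv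
    exact ⟨⟨(insert v A, w), hA.trans (Finset.subset_insert v A), hw⟩, rfl, hadj⟩
  choose nxt hnxt hadj using step
  obtain ⟨v, hv⟩ := f.exists_mem X
  let s : ℕ → {s : Finset V × V // X ⊆ s.1 ∧ s.2 ∈ f.toFun s.1} :=
    fun n => Nat.rec ⟨(X, v), subset_rfl, hv⟩ (fun _ => nxt) n
  have hs : ∀ n, (s (n + 1)).1.1 = insert (s n).1.2 (s n).1.1 := fun n => hnxt (s n)
  have hmem : ∀ i j, i < j → (s i).1.2 ∈ (s j).1.1 := by
    intro i j hij
    induction j, hij using Nat.le_induction with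
    | base => rw [hs]; exact Finset.mem_insert_self _ _
    | succ j _ ih => rw [hs]; exact Finset.mem_insert_of_mem ih
  have hne : ∀ i j, i < j → (s i).1.2 ≠ (s j).1.2 := fun i j hij e =>
    ComponentCompl.notMem_of_mem (s j).2.2 (e ▸ hmem i j hij)
  refine ⟨⟨fun n => (s n).1.2, fun i j e => ?_, fun n => hadj (s n)⟩,
    fun n => f.anti (s n).2.1 (s n).2.2⟩
  rcases lt_trichotomy i j with h | h | h
  · exact absurd e (hne i j h)
  · exact h
  · exact absurd e.symm (hne j i h)

end Direction

namespace Ray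

theorem mem_componentCompl_of_tail (R : G.Ray) (X : Finset V) {C : G.ComponentCompl (X : Set V)}
    {n : ℕ} (hn : ∀ i, n ≤ i → R.toFun i ∉ X) {i j : ℕ} (hi : n ≤ i) (hj : n ≤ j)
    (h : R.toFun i ∈ C) : R.toFun j ∈ C := by
  obtain ⟨p, hp⟩ := R.exists_walk_tail X n hn hi hj
  exact ComponentCompl.mem_of_walk h p (by simpa using hp)

/-- The direction defined by a ray: `X` is sent to the component of `G - X` that contains a tail
of the ray. -/
noncomputable def direction (R : G.Ray) : G.Direction where
  toFun X := G.componentComplMk (v := R.toFun (R.exists_tail X).choose)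
    (by simpa using (R.exists_tail X).choose_spec _ le_rfl)
  anti X Y hXY := by
    have hX := (R.exists_tail X).choose_spec
    have hY := (R.exists_tail Y).choose_spec
    refine ComponentCompl.subset_of_disjoint
      (v := R.toFun (max (R.exists_tail X).choose (R.exists_tail Y).choose)) ?_ ?_
      fun z hz hzX => ComponentCompl.notMem_of_mem hz (hXY hzX)
    · exact R.mem_componentCompl_of_tail Y hY le_rfl (le_max_right _ _) (componentComplMk_mem _ _)
    · exact R.mem_componentCompl_of_tail X hX le_rfl (le_max_left _ _) (componentComplMk_mem _ _)

theorem exists_tail_mem_direction (R : G.Ray) (X : Finset V) :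
    ∃ n, ∀ i, n ≤ i → R.toFun i ∈ R.direction.toFun X :=
  ⟨_, fun _ hi => R.mem_componentCompl_of_tail X (R.exists_tail X).choose_spec le_rfl hi
    (componentComplMk_mem _ _)⟩

theorem direction_toFun_eq (R : G.Ray) {X : Finset V} {C : G.ComponentCompl (X : Set V)}
    (h : ∃ n, ∀ i, n ≤ i → R.toFun i ∈ C) : R.direction.toFun X = C := by
  obtain ⟨n, hn⟩ := h
  obtain ⟨m, hm⟩ := R.exists_tail_mem_direction X
  exact ComponentCompl.eq_of_mem (hm _ (le_max_right n m)) (hn _ (le_max_left n m))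

theorem toEnd_eq_of_direction_eq {R S : G.Ray} (h : R.direction = S.direction) :
    R.toEnd = S.toEnd := by
  refine Quotient.sound fun X hX => ?_
  obtain ⟨n, hn⟩ := R.exists_tail_mem_direction X
  obtain ⟨m, hm⟩ := S.exists_tail_mem_direction X
  obtain ⟨p, hp⟩ := ComponentCompl.exists_walk (hn n le_rfl) (h ▸ hm m le_rfl)
  obtain ⟨x, hx, hxX⟩ := hX n m p
  exact hp x hx hxX

end Ray

/-! ### Normal trees given by parent functions -/

theorem Walk.exists_walk_first_mem {S : Set V} {u v : V} (p : G.Walk u v) (hv : v ∈ S) :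
    ∃ x ∈ S, ∃ q : G.Walk u x, ∀ z ∈ q.support, z ∈ S → z = x := by
  induction p with
  | nil => exact ⟨_, hv, Walk.nil, by simp⟩
  | @cons u w v h p ih =>
    by_cases hu : u ∈ S
    · exact ⟨u, hu, Walk.nil, by simp⟩
    · obtain ⟨x, hx, q, hq⟩ := ih hv
      refine ⟨x, hx, Walk.cons h q, fun z hz hzS => ?_⟩
      rw [Walk.support_cons, List.mem_cons] at hz
      rcases hz with rfl | hz
      · exact absurd hzS hu
      · exact hq z hz hzS

/-- A tree in `G` with root `r`, given by a parent function and a height function on its vertex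
set, that is normal in `G`. Values outside the vertex set are irrelevant. -/
structure ParentTree (G : SimpleGraph V) (r : V) where
  /-- The vertex set. -/
  carrier : Set V
  /-- The parent of a vertex; the root is its own parent. -/
  par : V → V
  /-- The height of a vertex above the root. -/
  ht : V → ℕ
  root_mem : r ∈ carrier
  par_root : par r = r
  par_mem : ∀ v ∈ carrier, par v ∈ carrier
  adj_par : ∀ v ∈ carrier, v ≠ r → G.Adj (par v) v
  ht_par : ∀ v ∈ carrier, v ≠ r → ht v = ht (par v) + 1
  normal : ∀ x ∈ carrier, ∀ y ∈ carrier, ∀ p : G.Walk x y,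
    (∀ z ∈ p.support, z ∈ carrier → z = x ∨ z = y) → (∃ k, par^[k] y = x) ∨ ∃ k, par^[k] x = y

namespace ParentTree

variable {r : V}

/-- The tree consisting of the root only. -/
def single (G : SimpleGraph V) (r : V) : G.ParentTree r where
  carrier := {r}
  par := id
  ht _ := 0
  root_mem := rfl
  par_root := rfl
  par_mem _ h := h
  adj_par _ h h' := absurd h h'
  ht_par _ h h' := absurd h h'
  normal _ hx _ hy _ _ := Or.inl ⟨0, (Set.mem_singleton_iff.1 hy).trans
    (Set.mem_singleton_iff.1 hx).symm⟩

/-- The tree `T'` extends the tree `T`. -/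
structure Extends (T' T : G.ParentTree r) : Prop where
  subset : T.carrier ⊆ T'.carrier
  par_eq : ∀ v ∈ T.carrier, T'.par v = T.par v
  ht_eq : ∀ v ∈ T.carrier, T'.ht v = T.ht v

theorem Extends.refl (T : G.ParentTree r) : T.Extends T :=
  ⟨subset_rfl, fun _ _ => rfl, fun _ _ => rfl⟩

theorem Extends.trans {T₁ T₂ T₃ : G.ParentTree r} (h : T₃.Extends T₂) (h' : T₂.Extends T₁) :
    T₃.Extends T₁ :=
  ⟨h'.subset.trans h.subset, fun v hv => (h.par_eq v (h'.subset hv)).trans (h'.par_eq v hv),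
    fun v hv => (h.ht_eq v (h'.subset hv)).trans (h'.ht_eq v hv)⟩

theorem iterate_par_mem (T : G.ParentTree r) {v : V} (hv : v ∈ T.carrier) (k : ℕ) :
    T.par^[k] v ∈ T.carrier := by
  induction k with
  | zero => exact hv
  | succ k ih => rw [Function.iterate_succ_apply']; exact T.par_mem _ ih

theorem ht_par_le (T : G.ParentTree r) {v : V} (hv : v ∈ T.carrier) : T.ht (T.par v) ≤ T.ht v := by
  by_cases h : v = r
  · rw [h, T.par_root]
  · rw [T.ht_par v hv h]; exact Nat.le_succ _

theorem ht_iterate_par_le (T : G.ParentTree r) {v : V} (hv : v ∈ T.carrier) (k : ℕ) :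
    T.ht (T.par^[k] v) ≤ T.ht v := by
  induction k with
  | zero => exact le_rfl
  | succ k ih =>
    rw [Function.iterate_succ_apply']
    exact (T.ht_par_le (T.iterate_par_mem hv k)).trans ih

theorem iterate_par_eq_self_of_ht_le (T : G.ParentTree r) {v : V} (hv : v ∈ T.carrier) {k : ℕ}
    (h : T.ht v ≤ T.ht (T.par^[k] v)) : T.par^[k] v = v := by
  cases k with
  | zero => rfl
  | succ k =>
    rw [Function.iterate_succ_apply] at h
    have h1 := T.ht_iterate_par_le (T.par_mem v hv) k
    by_cases hr : v = r
    · rw [hr]; exact Function.iterate_fixed T.par_root _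
    · have := T.ht_par v hv hr
      omega

theorem Extends.iterate_par_eq {T' T : G.ParentTree r} (h : T'.Extends T) {v : V}
    (hv : v ∈ T.carrier) (k : ℕ) : T'.par^[k] v = T.par^[k] v := by
  induction k with
  | zero => rfl
  | succ k ih =>
    rw [Function.iterate_succ_apply', Function.iterate_succ_apply', ih,
      h.par_eq _ (T.iterate_par_mem hv k)]

/-- Attach a new vertex `c` to the vertex `t` of `T`, if all vertices of `T` that can be reached
from `c` outside `T` lie below `t`. -/
theorem exists_attach (T : G.ParentTree r) {t c : V} (ht : t ∈ T.carrier) (hc : c ∉ T.carrier)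
    (htc : G.Adj t c)
    (H : ∀ x ∈ T.carrier, ∀ p : G.Walk c x, (∀ z ∈ p.support, z ∈ T.carrier → z = x) →
      ∃ k, T.par^[k] t = x) :
    ∃ T' : G.ParentTree r, T'.Extends T ∧ T'.carrier = insert c T.carrier ∧ T'.par c = t := by
  classical
  have hne : ∀ v ∈ T.carrier, v ≠ c := fun v hv e => hc (e ▸ hv)
  have hpar : ∀ v ∈ T.carrier, Function.update T.par c t v = T.par v := fun v hv =>
    Function.update_of_ne (hne v hv) _ _
  have hht : ∀ v ∈ T.carrier, Function.update T.ht c (T.ht t + 1) v = T.ht v := fun v hv =>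
    Function.update_of_ne (hne v hv) _ _
  have hiter : ∀ v ∈ T.carrier, ∀ k, (Function.update T.par c t)^[k] v = T.par^[k] v := by
    intro v hv k
    induction k with
    | zero => rfl
    | succ k ih =>
      rw [Function.iterate_succ_apply', Function.iterate_succ_apply', ih,
        hpar _ (T.iterate_par_mem hv k)]
  have hreach : ∀ x ∈ T.carrier, ∀ p : G.Walk c x,
      (∀ z ∈ p.support, z ∈ insert c T.carrier → z = c ∨ z = x) →
      ∃ k, (Function.update T.par c t)^[k] c = x := by
    intro x hx p hp
    obtain ⟨k, hk⟩ := H x hx p fun z hz hzT =>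
      (hp z hz (Set.mem_insert_of_mem _ hzT)).resolve_left (hne z hzT)
    refine ⟨k + 1, ?_⟩
    rw [Function.iterate_succ_apply, Function.update_self, hiter t ht, hk]
  refine ⟨⟨insert c T.carrier, Function.update T.par c t, Function.update T.ht c (T.ht t + 1),
    Set.mem_insert_of_mem _ T.root_mem, ?_, ?_, ?_, ?_, ?_⟩,
    ⟨Set.subset_insert _ _, hpar, hht⟩, rfl, Function.update_self c t T.par⟩
  · rw [hpar r T.root_mem, T.par_root]
  · rintro v (rfl | hv)
    · rw [Function.update_self]; exact Set.mem_insert_of_mem _ ht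
    · rw [hpar v hv]; exact Set.mem_insert_of_mem _ (T.par_mem v hv)
  · rintro v (rfl | hv) hr
    · rw [Function.update_self]; exact htc
    · rw [hpar v hv]; exact T.adj_par v hv hr
  · rintro v (rfl | hv) hr
    · rw [Function.update_self, Function.update_self, hht t ht]
    · rw [hpar v hv, hht v hv, hht _ (T.par_mem v hv)]; exact T.ht_par v hv hr
  · rintro x (rfl | hx) y (rfl | hy) p hp
    · exact Or.inl ⟨0, rfl⟩
    · exact Or.inr (hreach y hy p hp)
    · refine Or.inl (hreach x hx p.reverse fun z hz hzT => (hp z ?_ hzT).symm)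
      simpa using hz
    · rcases T.normal x hx y hy p fun z hz hzT => hp z hz (Set.mem_insert_of_mem _ hzT) with
        ⟨k, hk⟩ | ⟨k, hk⟩
      · exact Or.inl ⟨k, by rw [hiter y hy, hk]⟩
      · exact Or.inr ⟨k, by rw [hiter x hx, hk]⟩

/-- The path is attached one vertex at a time. Once `c` hangs on `t`, what the next vertex reaches
is either `c` itself or, on prefixing the edge from `c`, something that `c` reached, hence below
`t`; so the hypothesis `H` survives. -/
theorem exists_attach_path {c u : V} (q : G.Walk c u) (hq : q.IsPath) (T : G.ParentTree r)
    (hfin : T.carrier.Finite) {t : V} (ht : t ∈ T.carrier) (htc : G.Adj t c)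
    (havoid : ∀ z ∈ q.support, z ∉ T.carrier)
    (H : ∀ x ∈ T.carrier, ∀ p : G.Walk c x, (∀ z ∈ p.support, z ∈ T.carrier → z = x) →
      ∃ k, T.par^[k] t = x) :
    ∃ T' : G.ParentTree r, T'.Extends T ∧ T'.carrier.Finite ∧ u ∈ T'.carrier := by
  induction q generalizing T t with
  | nil =>
    obtain ⟨T', hT', hc, -⟩ := T.exists_attach ht (havoid _ (by simp)) htc H
    exact ⟨T', hT', hc ▸ hfin.insert _, hc ▸ Set.mem_insert _ _⟩
  | @cons c d u h q ih =>
    obtain ⟨T', hT', hc, hpar⟩ := T.exists_attach ht (havoid _ (by simp)) htc H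
    rw [Walk.cons_isPath_iff] at hq
    obtain ⟨T'', hT'', hfin'', hu⟩ := ih hq.1 T' (hc ▸ hfin.insert _) (t := c)
      (hc ▸ Set.mem_insert _ _) h (fun z hz => by
        rw [hc]
        rintro (rfl | hzT)
        · exact hq.2 hz
        · exact havoid z (by simp [hz]) hzT) (fun x hx p hp => by
        rw [hc] at hx hp
        rcases hx with rfl | hx
        · exact ⟨0, rfl⟩
        · obtain ⟨k, hk⟩ := H x hx (Walk.cons h p) fun z hz hzT => by
            rw [Walk.support_cons, List.mem_cons] at hz
            rcases hz with rfl | hz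
            · exact absurd hzT (havoid _ (by simp))
            · exact hp z hz (Set.mem_insert_of_mem _ hzT)
          refine ⟨k + 1, ?_⟩
          rw [Function.iterate_succ_apply, hpar, hT'.iterate_par_eq ht, hk])
    exact ⟨T'', hT''.trans hT', hfin'', hu⟩

/-- A finite normal tree extends to a finite normal tree containing a given vertex. -/
theorem exists_extends_mem (hG : G.Connected) (T : G.ParentTree r) (hfin : T.carrier.Finite)
    (u : V) : ∃ T' : G.ParentTree r, T'.Extends T ∧ T'.carrier.Finite ∧ u ∈ T'.carrier := by
  classical
  by_cases hu : u ∈ T.carrier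
  · exact ⟨T, Extends.refl T, hfin, hu⟩
  -- `N` is the set of tree vertices adjacent to the component of `u` outside `T`. Normality makes
  -- it a chain, so the path to `u` has to start at its highest vertex `t`: then all of `N` lies
  -- below `t`.
  let N : Set V := {x ∈ T.carrier | ∃ q : G.Walk u x, ∀ z ∈ q.support, z ∈ T.carrier → z = x}
  have hN : N.Nonempty := by
    obtain ⟨p⟩ := hG.preconnected u r
    exact p.exists_walk_first_mem T.root_mem
  obtain ⟨t, ⟨htT, q, hq⟩, hmax⟩ :=
    Set.exists_max_image N T.ht (hfin.subset (Set.sep_subset _ _)) hN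
  have hp := q.reverse.bypass_isPath
  have hpq : ∀ z ∈ q.reverse.bypass.support, z ∈ T.carrier → z = t := fun z hz => hq z (by
    simpa using q.reverse.support_bypass_subset_support hz)
  generalize q.reverse.bypass = p at hp hpq
  cases p with
  | nil => exact absurd htT hu
  | @cons _ c _ h p =>
    rw [Walk.cons_isPath_iff] at hp
    have havoid : ∀ z ∈ p.support, z ∉ T.carrier := fun z hz hzT =>
      hp.2 (hpq z (by simp [hz]) hzT ▸ hz)
    refine exists_attach_path p hp.1 T hfin htT h havoid fun x hx s hs => ?_
    have hxN : x ∈ N := ⟨hx, p.reverse.append s, fun z hz hzT => by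
      rcases Walk.mem_support_append_iff _ _ |>.1 hz with hz | hz
      · exact absurd hzT (havoid z (by simpa using hz))
      · exact hs z hz hzT⟩
    rcases T.normal t htT x hx (Walk.cons h s) (fun z hz hzT => by
      rw [Walk.support_cons, List.mem_cons] at hz
      exact hz.imp_right fun hz => hs z hz hzT) with ⟨k, hk⟩ | hk
    -- If `x` lies above `t`, the maximal height of `t` forces `x = t`.
    · have := T.iterate_par_eq_self_of_ht_le hx (k := k) (hk ▸ hmax x hxN)
      exact ⟨0, hk.symm.trans this⟩
    · exact hk

/-- The union of an increasing sequence of normal trees. -/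
theorem exists_iUnion (T : ℕ → G.ParentTree r) (hT : ∀ n, (T (n + 1)).Extends (T n)) :
    ∃ T' : G.ParentTree r, T'.carrier = ⋃ n, (T n).carrier := by
  classical
  have hle : ∀ m n, m ≤ n → (T n).Extends (T m) := by
    intro m n hmn
    induction n, hmn using Nat.le_induction with
    | base => exact Extends.refl _
    | succ n _ ih => exact (hT n).trans ih
  -- Values are read off the first tree that contains `v`; later trees agree with it, and values
  -- outside the union are irrelevant.
  let par : V → V := fun v => if h : ∃ n, v ∈ (T n).carrier then (T (Nat.find h)).par v else v
  let ht : V → ℕ := fun v => if h : ∃ n, v ∈ (T n).carrier then (T (Nat.find h)).ht v else 0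
  have hpar : ∀ n, ∀ v ∈ (T n).carrier, par v = (T n).par v := by
    intro n v hv
    have h : ∃ n, v ∈ (T n).carrier := ⟨n, hv⟩
    simp only [par, dif_pos h]
    exact ((hle _ n (Nat.find_min' h hv)).par_eq v (Nat.find_spec h)).symm
  have hht : ∀ n, ∀ v ∈ (T n).carrier, ht v = (T n).ht v := by
    intro n v hv
    have h : ∃ n, v ∈ (T n).carrier := ⟨n, hv⟩
    simp only [ht, dif_pos h]
    exact ((hle _ n (Nat.find_min' h hv)).ht_eq v (Nat.find_spec h)).symm
  have hiter : ∀ n, ∀ v ∈ (T n).carrier, ∀ k, par^[k] v = (T n).par^[k] v := by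
    intro n v hv k
    induction k with
    | zero => rfl
    | succ k ih =>
      rw [Function.iterate_succ_apply', Function.iterate_succ_apply', ih,
        hpar n _ ((T n).iterate_par_mem hv k)]
  refine ⟨⟨⋃ n, (T n).carrier, par, ht, ?_, ?_, ?_, ?_, ?_, ?_⟩, rfl⟩
  · exact Set.mem_iUnion_of_mem 0 (T 0).root_mem
  · rw [hpar 0 r (T 0).root_mem, (T 0).par_root]
  · intro v hv
    obtain ⟨n, hn⟩ := Set.mem_iUnion.1 hv
    rw [hpar n v hn]
    exact Set.mem_iUnion_of_mem n ((T n).par_mem v hn)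
  · intro v hv hr
    obtain ⟨n, hn⟩ := Set.mem_iUnion.1 hv
    rw [hpar n v hn]
    exact (T n).adj_par v hn hr
  · intro v hv hr
    obtain ⟨n, hn⟩ := Set.mem_iUnion.1 hv
    rw [hpar n v hn, hht n v hn, hht n _ ((T n).par_mem v hn)]
    exact (T n).ht_par v hn hr
  · intro x hx y hy p hp
    obtain ⟨m, hm⟩ := Set.mem_iUnion.1 hx
    obtain ⟨n, hn⟩ := Set.mem_iUnion.1 hy
    have hx' := (hle m _ (le_max_left m n)).subset hm
    have hy' := (hle n _ (le_max_right m n)).subset hn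
    rcases (T (max m n)).normal x hx' y hy' p
      (fun z hz hzT => hp z hz (Set.mem_iUnion_of_mem _ hzT)) with ⟨k, hk⟩ | ⟨k, hk⟩
    · exact Or.inl ⟨k, by rw [hiter _ y hy', hk]⟩
    · exact Or.inr ⟨k, by rw [hiter _ x hx', hk]⟩

theorem exists_countable_superset (hG : G.Connected) (r : V) {U : Set V} (hU : U.Countable) :
    ∃ T : G.ParentTree r, T.carrier.Countable ∧ U ⊆ T.carrier := by
  obtain rfl | hne := U.eq_empty_or_nonempty
  · exact ⟨single G r, Set.countable_singleton r, Set.empty_subset _⟩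
  obtain ⟨u, rfl⟩ := hU.exists_eq_range hne
  choose nxt hext hfin hmem using
    fun (n : ℕ) (s : {T : G.ParentTree r // T.carrier.Finite}) =>
      s.1.exists_extends_mem hG s.2 (u n)
  let s : ℕ → {T : G.ParentTree r // T.carrier.Finite} :=
    fun n => Nat.rec ⟨single G r, Set.finite_singleton r⟩ (fun n s => ⟨nxt n s, hfin n s⟩) n
  obtain ⟨T, hT⟩ := exists_iUnion (fun n => (s n).1) fun n => hext n (s n)
  refine ⟨T, hT ▸ Set.countable_iUnion fun n => (s n).2.countable, ?_⟩
  rintro _ ⟨n, rfl⟩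
  rw [hT]
  exact Set.mem_iUnion_of_mem (n + 1) (hmem n (s n))

/-- The subgraph of `G` formed by a tree given by a parent function. -/
def toSubgraph (T : G.ParentTree r) : G.Subgraph where
  verts := T.carrier
  Adj u v := (u ∈ T.carrier ∧ u ≠ r ∧ T.par u = v) ∨ (v ∈ T.carrier ∧ v ≠ r ∧ T.par v = u)
  adj_sub := by
    rintro u v (⟨hu, hr, rfl⟩ | ⟨hv, hr, rfl⟩)
    · exact (T.adj_par u hu hr).symm
    · exact T.adj_par v hv hr
  edge_vert := by
    rintro u v (⟨hu, hr, rfl⟩ | ⟨hv, hr, rfl⟩)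
    · exact hu
    · exact T.par_mem v hv
  symm := ⟨fun _ _ h => h.symm⟩

/-- The height bound is carried through the induction to show that `v` is not yet on the path to its
parent, so that appending `v` gives a path again. -/
theorem exists_isPath_toSubgraph (T : G.ParentTree r) (n : ℕ) (v : T.toSubgraph.verts)
    (hn : T.ht v = n) :
    ∃ p : T.toSubgraph.coe.Walk ⟨r, T.root_mem⟩ v, p.IsPath ∧ (∀ x ∈ p.support, T.ht x ≤ n) ∧
      ∀ u : T.toSubgraph.verts, (∃ k, T.par^[k] v = u) → u ∈ p.support := by
  induction n using Nat.strong_induction_on generalizing v with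
  | _ n ih =>
    obtain ⟨v, hv⟩ := v
    by_cases hr : v = r
    · subst hr
      refine ⟨Walk.nil, Walk.IsPath.nil, fun x hx => ?_, fun u hu => ?_⟩
      · rw [Walk.support_nil, List.mem_singleton] at hx
        subst hx; exact hn.le
      · obtain ⟨k, hk⟩ := hu
        rw [Function.iterate_fixed T.par_root] at hk
        rw [Walk.support_nil, List.mem_singleton]
        exact Subtype.ext hk.symm
    · have hht := T.ht_par v hv hr
      replace hn : T.ht v = n := hn
      obtain ⟨p, hp, hle, hmem⟩ := ih (T.ht (T.par v)) (by omega) ⟨T.par v, T.par_mem v hv⟩ rfl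
      have hadj : T.toSubgraph.coe.Adj ⟨T.par v, T.par_mem v hv⟩ ⟨v, hv⟩ :=
        Or.inr ⟨hv, hr, rfl⟩
      refine ⟨p.concat hadj, hp.concat (fun h => ?_) hadj, fun x hx => ?_, fun u hu => ?_⟩
      · have := hle _ h
        simp only at this
        omega
      · rw [Walk.support_concat, List.mem_append, List.mem_singleton] at hx
        rcases hx with hx | rfl
        · have := hle _ hx
          omega
        · exact hn.le
      · rw [Walk.support_concat, List.mem_append, List.mem_singleton]
        obtain ⟨k, hk⟩ := hu
        cases k with
        | zero => exact Or.inr (Subtype.ext hk.symm)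
        | succ k => exact Or.inl (hmem u ⟨k, hk⟩)

/-- Every edge from a vertex `v` to its parent is a bridge: without that edge, a walk from `v` can
never leave the descendants of `v`, and the parent is too low to be one of them. -/
theorem isAcyclic_toSubgraph (T : G.ParentTree r) : T.toSubgraph.coe.IsAcyclic := by
  have key : ∀ v : T.toSubgraph.verts, (v : V) ≠ r → ∀ w : T.toSubgraph.verts,
      T.par v = w → T.toSubgraph.coe.IsBridge s(v, w) := by
    intro v hr w hw
    rw [isBridge_iff]
    rintro ⟨p⟩
    have hstay : ∀ {a b : T.toSubgraph.verts}
        (_ : (T.toSubgraph.coe.deleteEdges {s(v, w)}).Walk a b),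
        (∃ k, T.par^[k] a = v) → ∃ k, T.par^[k] b = v := by
      intro a b p
      induction p with
      | nil => exact id
      | @cons a b _ h _ ih =>
        rintro ⟨k, hk⟩
        rw [deleteEdges_adj] at h
        refine ih ?_
        rcases h.1 with ⟨ha, har, hab⟩ | ⟨hb, hbr, hab⟩
        · cases k with
          | zero =>
            have hav : a = v := Subtype.ext hk
            have hbw : b = w := Subtype.ext (by rw [← hab, hav, hw])
            exact absurd (by rw [hav, hbw]; rfl) h.2
          | succ k => exact ⟨k, by rw [Function.iterate_succ_apply] at hk; rw [← hab]; exact hk⟩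
        · exact ⟨k + 1, by rw [Function.iterate_succ_apply, hab, hk]⟩
    obtain ⟨k, hk⟩ := hstay p ⟨0, rfl⟩
    have h1 := T.ht_iterate_par_le w.2 k
    have h2 := T.ht_par v v.2 hr
    rw [hk, ← hw] at h1
    omega
  rw [isAcyclic_iff_forall_adj_isBridge]
  rintro v w (⟨hv, hr, hvw⟩ | ⟨hw, hr, hvw⟩)
  · exact key v hr w hvw
  · rw [Sym2.eq_swap]
    exact key w hr v hvw

theorem isNormalTree_toSubgraph (T : G.ParentTree r) :
    T.toSubgraph.IsNormalTree ⟨r, T.root_mem⟩ := by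
  refine ⟨⟨?_, T.isAcyclic_toSubgraph⟩, fun u v p hp => ?_⟩
  · have : Nonempty T.toSubgraph.verts := ⟨⟨r, T.root_mem⟩⟩
    refine ⟨fun u v => ?_⟩
    obtain ⟨p, -⟩ := T.exists_isPath_toSubgraph _ u rfl
    obtain ⟨q, -⟩ := T.exists_isPath_toSubgraph _ v rfl
    exact ⟨p.reverse.append q⟩
  · refine (T.normal u u.2 v v.2 p fun z hz hzT => (hp.2.2 z hz).1 hzT).imp ?_ ?_
    · intro h
      obtain ⟨p, hp, -, hmem⟩ := T.exists_isPath_toSubgraph _ v rfl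
      exact ⟨p, hp, hmem u h⟩
    · intro h
      obtain ⟨p, hp, -, hmem⟩ := T.exists_isPath_toSubgraph _ u rfl
      exact ⟨p, hp, hmem v h⟩

end ParentTree

/-- Every countable set of vertices of a connected graph lies in a countable normal tree. -/
theorem Connected.exists_isNormalTree_superset (hG : G.Connected) {U : Set V} (hU : U.Countable) :
    ∃ (T : G.Subgraph) (r : T.verts), T.verts.Countable ∧ T.IsNormalTree r ∧ U ⊆ T.verts := by
  obtain ⟨r⟩ := hG.nonempty
  obtain ⟨T, hT, hUT⟩ := ParentTree.exists_countable_superset hG r hU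
  exact ⟨T.toSubgraph, ⟨r, T.root_mem⟩, hT, T.isNormalTree_toSubgraph, hUT⟩

/-! ### Connectivity in normal trees -/

theorem Walk.IsPath.append_of_disjoint {u v w : V} {p : G.Walk u v} {q : G.Walk v w}
    (hp : p.IsPath) (hq : q.IsPath) (h : ∀ z ∈ p.support, z ∈ q.support → z = v) :
    (p.append q).IsPath := by
  induction p with
  | nil => exact hq
  | cons a p ih =>
    rw [Walk.cons_isPath_iff] at hp
    rw [Walk.cons_append, Walk.cons_isPath_iff]
    refine ⟨ih hp.1 hq fun z hz => h z (by simp [hz]), fun hu => ?_⟩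
    rcases Walk.mem_support_append_iff _ _ |>.1 hu with hu | hu
    · exact hp.2 hu
    · exact hp.2 (h _ (by simp) hu ▸ p.end_mem_support)

namespace Subgraph

/-- The vertex set `A` is closed downwards in the tree-order of `T`. -/
def IsDownClosed (T : G.Subgraph) (r : T.verts) (A : Set V) : Prop :=
  ∀ u v : T.verts, T.coe.TreeLE r u v → (v : V) ∈ A → (u : V) ∈ A

variable {T : G.Subgraph} {r : T.verts}

theorem exists_walk_of_treeLE {A : Set V} (hA : T.IsDownClosed r A) {u v : T.verts}
    (h : T.coe.TreeLE r u v) (hu : (u : V) ∉ A) :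
    ∃ p : T.coe.Walk u v, ∀ z ∈ p.support, (z : V) ∉ A := by
  classical
  obtain ⟨p, hp, hup⟩ := h
  refine ⟨p.dropUntil u hup, fun z hz hzA => hu (hA u z ?_ hzA)⟩
  refine ⟨(p.takeUntil u hup).append ((p.dropUntil u hup).takeUntil z hz), ?_, by simp⟩
  refine Walk.IsPath.of_append_left (q := (p.dropUntil u hup).dropUntil z hz) ?_
  rwa [← Walk.append_assoc, Walk.take_spec, Walk.take_spec]

/-- Induction along a walk of `G - A`, where `q` is the current excursion outside `T` since the last
tree vertex `s`. When the excursion returns to `T`, it yields a `T`-path, so its ends are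
comparable; the tree path between them lies above the lower end and therefore avoids the down-closed
set `A`. -/
theorem IsNormalTree.exists_walk_of_walk_append (hT : T.IsNormalTree r) {A : Set V}
    (hA : T.IsDownClosed r A) {w s' : V} (hs' : s' ∈ T.verts) (p : G.Walk w s')
    (hp : ∀ z ∈ p.support, z ∉ A) (s : T.verts) (q : G.Walk s w)
    (hq : ∀ z ∈ q.support, z ∉ A) (hqT : ∀ z ∈ q.support, z ∈ T.verts → z = s) :
    ∃ p : T.coe.Walk s ⟨s', hs'⟩, ∀ z ∈ p.support, (z : V) ∉ A := by
  classical
  induction p generalizing s with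
  | nil =>
    obtain rfl : (⟨_, hs'⟩ : T.verts) = s := Subtype.ext (hqT _ q.end_mem_support hs')
    exact ⟨Walk.nil, by simpa using hq _ q.start_mem_support⟩
  | @cons w w' s' h p ih =>
    have hp' : ∀ z ∈ p.support, z ∉ A := fun z hz => hp z (by simp [hz])
    have hw' := hp' _ p.start_mem_support
    by_cases hwT : w' ∈ T.verts
    · obtain ⟨p₂, hp₂⟩ := ih hs' hp' ⟨w', hwT⟩ Walk.nil (by simpa using hw') (by simp)
      by_cases hsw : (s : V) = w'
      · obtain rfl : s = ⟨w', hwT⟩ := Subtype.ext hsw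
        exact ⟨p₂, hp₂⟩
      · have hpath : T.IsSubgraphPath (q.concat h).bypass := by
          refine ⟨Walk.bypass_isPath _, ?_, fun z hz => ⟨fun hzT => ?_, ?_⟩⟩
          · exact Nat.pos_of_ne_zero fun h0 => hsw (Walk.eq_of_length_eq_zero h0)
          · have hz' := Walk.support_bypass_subset_support _ hz
            rw [Walk.support_concat, List.mem_append, List.mem_singleton] at hz'
            exact hz'.imp_left fun hz' => hqT z hz' hzT
          · rintro (rfl | rfl)
            · exact s.2
            · exact hwT
        obtain ⟨p₁, hp₁⟩ : ∃ p : T.coe.Walk s ⟨w', hwT⟩, ∀ z ∈ p.support, (z : V) ∉ A := by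
          rcases hT.2 s ⟨w', hwT⟩ _ hpath with hle | hle
          · exact exists_walk_of_treeLE hA hle (hq _ q.start_mem_support)
          · obtain ⟨p₁, hp₁⟩ := exists_walk_of_treeLE hA hle hw'
            exact ⟨p₁.reverse, fun z hz => hp₁ z (by simpa using hz)⟩
        refine ⟨p₁.append p₂, fun z hz => ?_⟩
        rcases Walk.mem_support_append_iff _ _ |>.1 hz with hz | hz
        · exact hp₁ z hz
        · exact hp₂ z hz
    · refine ih hs' hp' s (q.concat h) (fun z hz => ?_) fun z hz hzT => ?_
      all_goals rw [Walk.support_concat, List.mem_append, List.mem_singleton] at hz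
      · rcases hz with hz | rfl
        · exact hq z hz
        · exact hw'
      · rcases hz with hz | rfl
        · exact hqT z hz hzT
        · exact absurd hzT hwT

/-- If `A` is closed downwards in the normal tree `T`, then vertices of `T` in the same component
of `G - A` are joined by a path in `T - A`. -/
theorem IsNormalTree.exists_isPath_avoiding (hT : T.IsNormalTree r) {A : Set V}
    (hA : T.IsDownClosed r A) {C : G.ComponentCompl A} {s s' : T.verts} (hs : (s : V) ∈ C)
    (hs' : (s' : V) ∈ C) :
    ∃ p : T.coe.Walk s s', p.IsPath ∧ ∀ z ∈ p.support, (z : V) ∉ A := by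
  classical
  obtain ⟨p, hp⟩ := ComponentCompl.exists_walk hs hs'
  obtain ⟨q, hq⟩ := hT.exists_walk_of_walk_append hA s'.2 p hp s Walk.nil
    (by simpa using hp _ p.start_mem_support) (by simp)
  exact ⟨q.bypass, q.bypass_isPath, fun z hz => hq z (q.support_bypass_subset_support hz)⟩

theorem mem_component_of_coe_walk {A : Set V} {C : G.ComponentCompl A} {s s' : T.verts}
    (hs : (s : V) ∈ C) (p : T.coe.Walk s s') (hp : ∀ z ∈ p.support, (z : V) ∉ A) :
    (s' : V) ∈ C := by
  refine ComponentCompl.mem_of_walk hs (p.map T.hom) fun z hz => ?_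
  obtain ⟨y, hy, rfl⟩ := List.mem_map.1 (Walk.support_map _ p ▸ hz)
  exact hp y hy

theorem IsNormalTree.mem_support_of_treeLE (hT : T.IsNormalTree r) {u v : T.verts}
    (h : T.coe.TreeLE r u v) (p : T.coe.Walk r v) (hp : p.IsPath) : u ∈ p.support := by
  obtain ⟨q, hq, hu⟩ := h
  rwa [(hT.1.existsUnique_path r v).unique hp hq]

/-- Every finite vertex set extends by vertices of the tree to a finite set that is closed
downwards. -/
theorem IsNormalTree.exists_isDownClosed (hT : T.IsNormalTree r) (A : Finset V) :
    ∃ B : Finset V, A ⊆ B ∧ T.IsDownClosed r B ∧ ∀ x ∈ B, x ∈ A ∨ x ∈ T.verts := by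
  classical
  choose p hp using fun v => (hT.1.existsUnique_path r v).exists
  refine ⟨A ∪ A.biUnion fun v => if hv : v ∈ T.verts then
    (p ⟨v, hv⟩).support.toFinset.image Subtype.val else ∅, Finset.subset_union_left, ?_, ?_⟩
  · have key : ∀ u v w : T.verts, T.coe.TreeLE r u v → v ∈ (p w).support → (w : V) ∈ A →
        (u : V) ∈ A ∪ A.biUnion fun v => if hv : v ∈ T.verts then
          (p ⟨v, hv⟩).support.toFinset.image Subtype.val else ∅ := by
      intro u v w huv hv hw
      refine Finset.mem_union_right _ (Finset.mem_biUnion.2 ⟨w, hw, ?_⟩)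
      rw [dif_pos w.2]
      refine Finset.mem_image_of_mem _ (List.mem_toFinset.2 ?_)
      exact (p w).support_takeUntil_subset_support hv
        (hT.mem_support_of_treeLE huv _ ((hp w).takeUntil hv))
    intro u v huv hv
    rw [Finset.mem_coe, Finset.mem_union, Finset.mem_biUnion] at hv
    rcases hv with hv | ⟨w, hw, hv⟩
    · exact key u v v huv (Walk.end_mem_support _) hv
    · split_ifs at hv with hwT
      · obtain ⟨v', hv', he⟩ := Finset.mem_image.1 hv
        obtain rfl : v' = v := Subtype.ext he
        exact key u v' ⟨w, hwT⟩ huv (List.mem_toFinset.1 hv') hw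
      · simp at hv
  · intro x hx
    rw [Finset.mem_union, Finset.mem_biUnion] at hx
    refine hx.imp_right ?_
    rintro ⟨w, -, hx⟩
    split_ifs at hx
    · obtain ⟨y, -, rfl⟩ := Finset.mem_image.1 hx
      exact y.2
    · simp at hx

theorem IsNormalTree.exists_isPath_support_subset (hT : T.IsNormalTree r) {A : Set V}
    (hA : T.IsDownClosed r A) {v : T.verts} (hv : (v : V) ∈ A) :
    ∃ p : T.coe.Walk r v, p.IsPath ∧ ∀ z ∈ p.support, (z : V) ∈ A := by
  obtain ⟨p, hp, -⟩ := hT.1.existsUnique_path r v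
  exact ⟨p, hp, fun z hz => hA z v ⟨p, hp, hz⟩ hv⟩

/-- A vertex `v` all of whose predecessors lie in the set `A` lies below the vertices to which it
is joined by a path of the tree outside `A`. -/
theorem IsNormalTree.treeLE_of_isPath_avoiding [DecidableEq V] (hT : T.IsNormalTree r)
    {A : Finset V} {v z : T.verts} (hA : T.IsDownClosed r (insert (v : V) A : Finset V))
    (p : T.coe.Walk v z) (hp : p.IsPath) (hpA : ∀ z ∈ p.support, (z : V) ∉ A) :
    T.coe.TreeLE r v z := by
  obtain ⟨q, hq, hqA⟩ := hT.exists_isPath_support_subset hA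
    (Finset.mem_coe.2 (Finset.mem_insert_self (v : V) A))
  refine ⟨q.append p, hq.append_of_disjoint hp fun y hy hyp => ?_, by simp⟩
  have := hqA y hy
  rw [Finset.mem_coe, Finset.mem_insert] at this
  exact Subtype.ext (this.resolve_right (hpA y hyp))

theorem IsNormalTree.isDownClosed_insert [DecidableEq V] (hT : T.IsNormalTree r)
    {A : Finset V} (hA : T.IsDownClosed r A) {v w : T.verts} (hv : (v : V) ∈ A)
    (hw : (w : V) ∉ A) (hadj : T.coe.Adj v w) :
    T.IsDownClosed r (insert (w : V) A : Finset V) := by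
  intro u x hux hx
  rw [Finset.mem_coe, Finset.mem_insert] at hx ⊢
  rcases hx with hx | hx
  · obtain rfl : x = w := Subtype.ext hx
    obtain ⟨q, hq, hqA⟩ := hT.exists_isPath_support_subset hA hv
    have := hT.mem_support_of_treeLE hux (q.concat hadj) (hq.concat (fun h => hw (hqA _ h)) hadj)
    rw [Walk.support_concat, List.mem_append, List.mem_singleton] at this
    rcases this with h | rfl
    · exact Or.inr (hqA u h)
    · exact Or.inl rfl
  · exact Or.inr (hA u x hux hx)

theorem IsNormalTree.isDownClosed_root (hT : T.IsNormalTree r) :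
    T.IsDownClosed r ({(r : V)} : Set V) := by
  intro u v huv hv
  obtain rfl : v = r := Subtype.ext hv
  have := hT.mem_support_of_treeLE huv Walk.nil Walk.IsPath.nil
  rw [Walk.support_nil, List.mem_singleton] at this
  exact congrArg Subtype.val this

/-- If a direction always chooses components that meet the normal tree `T`, as far as finite
subsets of `T` are concerned, then `T` contains a ray with a tail in all those components. -/
theorem IsNormalTree.exists_ray (hT : T.IsNormalTree r) (f : G.Direction)
    (hf : ∀ A : Finset V, (A : Set V) ⊆ T.verts → ∃ s ∈ f.toFun A, s ∈ T.verts) :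
    ∃ R : G.Ray, R.IsContainedIn T ∧ ∀ A : Finset V, (A : Set V) ⊆ T.verts →
      R.direction.toFun A = f.toFun A := by
  classical
  -- The invariant makes `v` a minimal tree vertex outside the down-closed set `A`, so that the part
  -- of `T - A` reachable from `v` lies above `v`.
  let I : Finset V × T.verts → Prop := fun s => (s.1 : Set V) ⊆ T.verts ∧
    T.IsDownClosed r s.1 ∧ T.IsDownClosed r (insert (s.2 : V) s.1 : Finset V) ∧
    (s.2 : V) ∈ f.toFun s.1
  have hsub : ∀ (v : T.verts) (A : Finset V), (A : Set V) ⊆ T.verts →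
      ((insert (v : V) A : Finset V) : Set V) ⊆ T.verts := by
    intro v A hA
    rw [Finset.coe_insert]
    exact Set.insert_subset v.2 hA
  have step : ∀ s : {s // I s}, ∃ s' : {s // I s},
      s'.1.1 = insert (s.1.2 : V) s.1.1 ∧ T.Adj s.1.2 s'.1.2 := by
    rintro ⟨⟨A, v⟩, hAT, hA, hvA, hv⟩
    dsimp only at hAT hA hvA hv
    -- The next vertex of the ray is the second vertex of a path in `T - A` from `v` to a tree
    -- vertex of the component chosen for `A ∪ {v}`.
    obtain ⟨s, hs, hsT⟩ := hf _ (hsub v A hAT)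
    obtain ⟨p, hp, hpA⟩ := hT.exists_isPath_avoiding hA (s := v) (s' := ⟨s, hsT⟩) hv
      (f.anti (Finset.subset_insert _ _) hs)
    cases p with
    | nil => exact absurd (Finset.mem_insert_self _ _) (ComponentCompl.notMem_of_mem hs)
    | @cons _ w _ h p =>
      rw [Walk.cons_isPath_iff] at hp
      have havoid : ∀ z ∈ p.support, (z : V) ∉ (insert (v : V) A : Finset V) := by
        intro z hz hzA
        rw [Finset.mem_insert] at hzA
        rcases hzA with hzv | hzA
        · exact hp.2 (Subtype.ext hzv ▸ hz)
        · exact hpA z (by simp [hz]) hzA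
      refine ⟨⟨(insert (v : V) A, w), hsub v A hAT, hvA, ?_, ?_⟩, rfl, h⟩
      · exact hT.isDownClosed_insert hvA (Finset.mem_insert_self _ _)
          (havoid _ p.start_mem_support) h
      · exact mem_component_of_coe_walk (s := ⟨s, hsT⟩) hs p.reverse fun z hz =>
          havoid z (by simpa using hz)
  choose nxt hnxt hadj using step
  have hrf : (r : V) ∈ f.toFun ∅ := by
    obtain ⟨s, hs, hsT⟩ := hf ∅ (by simp)
    obtain ⟨p⟩ := hT.1.connected.preconnected ⟨s, hsT⟩ r
    exact mem_component_of_coe_walk (s := ⟨s, hsT⟩) hs p (by simp)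
  let s : ℕ → {s // I s} := fun n => Nat.rec ⟨(∅, r), by simp, fun _ _ _ h => by simp at h,
    by simpa using hT.isDownClosed_root, hrf⟩ (fun _ => nxt) n
  have hs : ∀ n, (s (n + 1)).1.1 = insert ((s n).1.2 : V) (s n).1.1 := fun n => hnxt (s n)
  have hmem : ∀ i j, i < j → ((s i).1.2 : V) ∈ (s j).1.1 := by
    intro i j hij
    induction j, hij using Nat.le_induction with
    | base => rw [hs]; exact Finset.mem_insert_self _ _
    | succ j _ ih => rw [hs]; exact Finset.mem_insert_of_mem ih
  have hne : ∀ i j, i < j → ((s i).1.2 : V) ≠ (s j).1.2 := fun i j hij e =>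
    ComponentCompl.notMem_of_mem (s j).2.2.2.2 (e ▸ hmem i j hij)
  let R : G.Ray := ⟨fun n => (s n).1.2, fun i j e => by
    rcases lt_trichotomy i j with h | h | h
    · exact absurd e (hne i j h)
    · exact h
    · exact absurd e.symm (hne j i h), fun n => (hadj (s n)).adj_sub⟩
  refine ⟨R, fun n => hadj (s n), fun A hAT => R.direction_toFun_eq ?_⟩
  obtain ⟨B, hAB, hB, hBT⟩ := hT.exists_isDownClosed A
  obtain ⟨n, hn⟩ := R.exists_tail B
  refine ⟨n, fun i hi => f.anti hAB ?_⟩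
  have hiB : ((s i).1.2 : V) ∉ B := hn i hi
  obtain ⟨hAT', hA', hvA', hv'⟩ := (s i).2
  -- The tree path from the ray vertex to `x` stays above the ray vertex. As the latter is outside
  -- the down-closed set `B`, so is the whole path.
  obtain ⟨x, hx, hxT⟩ := hf (B ∪ (s i).1.1) (by
    rw [Finset.coe_union]
    exact Set.union_subset (fun y hy => (hBT y hy).elim (fun h => hAT h) id) hAT')
  obtain ⟨p, hp, hpA⟩ := hT.exists_isPath_avoiding hA' (s := (s i).1.2) (s' := ⟨x, hxT⟩) hv'
    (f.anti Finset.subset_union_right hx)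
  refine mem_component_of_coe_walk (s := ⟨x, hxT⟩) (f.anti Finset.subset_union_left hx) p.reverse
    fun z hz hzB => hiB (hB _ z ?_ hzB)
  have hz' : z ∈ p.support := by simpa using hz
  exact hT.treeLE_of_isPath_avoiding hvA' (p.takeUntil z hz') (hp.takeUntil hz') fun y hy =>
    hpA y (p.support_takeUntil_subset_support hz' hy)

end Subgraph

/-! ### Countably determined graphs -/

theorem _root_.Set.Countable.finset_subset {α : Type*} {S : Set α} (hS : S.Countable) :
    {A : Finset α | (A : Set α) ⊆ S}.Countable :=
  Set.MapsTo.countable_of_injOn (f := fun A : Finset α => (A : Set α))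
    (t := {B | B.Finite ∧ B ⊆ S}) (fun A hA => ⟨A.finite_toSet, hA⟩) Finset.coe_injective.injOn
    (Set.countable_ofPred_finite_subset hS)

/-- Enlarge a distinguishing set to a down-closed `B` and keep only `B ∩ T`. If the directions
agreed there, tree vertices of their components for `B` would be joined by a tree path outside `B ∩
T`. Such a path avoids all of `B`, so the two components would coincide. -/
theorem Subgraph.IsNormalTree.exists_toFun_ne {T : G.Subgraph} {r : T.verts}
    (hT : T.IsNormalTree r) (hmeet : ∀ (f : G.Direction) X, ∃ s ∈ f.toFun X, s ∈ T.verts)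
    {f h : G.Direction} (hfh : f ≠ h) :
    ∃ A : Finset V, (A : Set V) ⊆ T.verts ∧ f.toFun A ≠ h.toFun A := by
  classical
  obtain ⟨X, hX⟩ := Function.ne_iff.1 (Direction.toFun_injective.ne hfh)
  obtain ⟨B, hXB, hB, -⟩ := hT.exists_isDownClosed X
  have hBA : B.filter (· ∈ T.verts) ⊆ B := Finset.filter_subset _ _
  refine ⟨B.filter (· ∈ T.verts), fun x hx => (Finset.mem_filter.1 hx).2, fun he => hX ?_⟩
  refine Direction.toFun_eq_of_subset hXB ?_
  obtain ⟨s, hs, hsT⟩ := hmeet f B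
  obtain ⟨s', hs', hsT'⟩ := hmeet h B
  obtain ⟨p, -, hp⟩ := hT.exists_isPath_avoiding (A := (B.filter (· ∈ T.verts) : Finset V))
    (fun u v huv hv => by
      rw [Finset.mem_coe, Finset.mem_filter] at hv ⊢
      exact ⟨hB u v huv hv.1, u.2⟩)
    (s := ⟨s, hsT⟩) (s' := ⟨s', hsT'⟩) (f.anti hBA hs) (he ▸ h.anti hBA hs')
  refine ComponentCompl.eq_of_mem (Subgraph.mem_component_of_coe_walk (s := ⟨s, hsT⟩) hs p ?_) hs'
  exact fun z hz hzB => hp z hz (Finset.mem_coe.2 (Finset.mem_filter.2 ⟨hzB, z.2⟩))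

theorem Subgraph.IsNormalTree.isCountablyDetermined {T : G.Subgraph} {r : T.verts}
    (hT : T.IsNormalTree r) (hcount : T.verts.Countable)
    (hends : ∀ ω : G.RayEnd, ∃ R : G.Ray, R.IsContainedIn T ∧ R.toEnd = ω) :
    G.IsCountablyDetermined := by
  have hmeet : ∀ (f : G.Direction) X, ∃ s ∈ f.toFun X, s ∈ T.verts := by
    intro f X
    obtain ⟨S, hS⟩ := f.exists_ray X
    obtain ⟨R, hRT, hRS⟩ := hends S.toEnd
    have heq : R.Equivalent S := Quotient.exact hRS
    have := heq X
    simp only [Ray.SeparatedBy, not_forall, not_exists, not_and] at this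
    obtain ⟨i, j, p, hp⟩ := this
    refine ⟨R.toFun i, ComponentCompl.mem_of_walk (hS j) p.reverse fun z hz => ?_,
      (hRT i).fst_mem⟩
    exact hp z (by simpa using hz)
  refine ⟨{c | (c.1 : Set V) ⊆ T.verts ∧ ∃ s ∈ c.2, s ∈ T.verts}, ?_, fun f h hfh => ?_⟩
  -- A choice in this set is determined by its finite set and any tree vertex in its component.
  · have : (⋃ A ∈ {A : Finset V | (A : Set V) ⊆ T.verts}, ⋃ s ∈ T.verts,
        {c : G.DirectionalChoice | c.1 = A ∧ s ∈ c.2}).Countable := by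
      refine hcount.finset_subset.biUnion fun A _ => hcount.biUnion fun s _ =>
        Set.Subsingleton.countable ?_
      rintro ⟨_, C⟩ ⟨rfl, hC⟩ ⟨_, C'⟩ ⟨he, hC'⟩
      dsimp only at he
      subst he
      exact congrArg (Sigma.mk _) (ComponentCompl.eq_of_mem hC hC')
    refine this.mono ?_
    rintro c ⟨hc, s, hs, hsT⟩
    exact Set.mem_biUnion hc (Set.mem_biUnion hsT ⟨rfl, hs⟩)
  · obtain ⟨A, hA, hne⟩ := hT.exists_toFun_ne hmeet hfh
    exact ⟨⟨A, f.toFun A⟩, ⟨hA, hmeet f A⟩, rfl, hne.symm⟩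

/-! ### Directions that avoid a vertex set -/

/-- A walk in `G - N` that starts in `f A` cannot leave it, since it would have to enter `A` at a
neighbour of `f A`, and these all lie in `N`. -/
theorem Direction.toFun_subset_of_boundary (f : G.Direction) {N A : Finset V} (hNA : N ⊆ A)
    (h : ∀ x ∈ A, ∀ y ∈ f.toFun A, G.Adj y x → x ∈ N) :
    (f.toFun N : Set V) ⊆ f.toFun A := by
  intro w hw
  obtain ⟨v, hv⟩ := f.exists_mem A
  obtain ⟨p, hp⟩ := ComponentCompl.exists_walk (f.anti hNA hv) hw
  clear hw
  induction p with
  | nil => exact hv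
  | cons hadj p ih =>
    refine ih (ComponentCompl.mem_of_adj _ _ hv (fun hA => ?_) hadj) fun z hz => hp z (by simp [hz])
    exact hp _ (by simp) (h _ hA _ hv hadj)

/-- The directions that send `N` to a component avoiding `S` whose neighbourhood is `N`. -/
def directionsAvoiding (G : SimpleGraph V) (S : Set V) (N : Finset V) : Set G.Direction :=
  {f | (∀ z ∈ f.toFun N, z ∉ S) ∧ ∀ x ∈ N, ∃ y ∈ f.toFun N, G.Adj y x}

theorem Direction.exists_mem_directionsAvoiding (f : G.Direction) {S : Set V} {A : Finset V}
    (hA : ∀ z ∈ f.toFun A, z ∉ S) : ∃ N ⊆ A, f ∈ G.directionsAvoiding S N := by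
  classical
  have hsub : A.filter (fun x => ∃ y ∈ f.toFun A, G.Adj y x) ⊆ A := Finset.filter_subset _ _
  refine ⟨_, hsub, fun z hz => hA z (f.toFun_subset_of_boundary hsub ?_ hz), fun x hx => ?_⟩
  · exact fun x hx y hy hadj => Finset.mem_filter.2 ⟨hx, y, hy, hadj⟩
  · obtain ⟨y, hy, hadj⟩ := (Finset.mem_filter.1 hx).2
    exact ⟨y, f.anti hsub hy, hadj⟩

theorem Direction.eq_of_toFun_eq_of_subset {D : Set G.DirectionalChoice}
    (hD : ∀ f h : G.Direction, f ≠ h → ∃ c ∈ D, c.Distinguishes f h ∨ c.Distinguishes h f)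
    {S : Set V} (hS : ∀ c ∈ D, (c.1 : Set V) ⊆ S)
    {f h : G.Direction}
    (he : ∀ X : Finset V, (X : Set V) ⊆ S → f.toFun X = h.toFun X) : f = h := by
  by_contra hne
  obtain ⟨c, hc, hfh | hfh⟩ := hD f h hne
  · exact hfh.2 ((he _ (hS c hc)).symm.trans hfh.1)
  · exact hfh.2 ((he _ (hS c hc)).trans hfh.1)

/-- A component `f N` that avoids `S` lies inside `f X` for every finite `X ⊆ S`, so it fixes all
values that matter for `D`. -/
theorem Direction.eq_of_toFun_eq_of_disjoint {D : Set G.DirectionalChoice}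
    (hD : ∀ f h : G.Direction, f ≠ h → ∃ c ∈ D, c.Distinguishes f h ∨ c.Distinguishes h f)
    {S : Set V} (hS : ∀ c ∈ D, (c.1 : Set V) ⊆ S)
    {f h : G.Direction} {N : Finset V}
    (hN : ∀ z ∈ f.toFun N, z ∉ S) (he : f.toFun N = h.toFun N) : f = h := by
  refine Direction.eq_of_toFun_eq_of_subset hD hS fun X hX => ?_
  obtain ⟨v, hv⟩ := f.exists_mem N
  refine ComponentCompl.eq_of_mem (f.subset_of_disjoint (fun z hz hzX => hN z hz (hX hzX)) hv)
    (h.subset_of_disjoint (fun z hz hzX => hN z ?_ (hX hzX)) (he ▸ hv))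
  rwa [he]

theorem countable_directionsAvoiding {D : Set G.DirectionalChoice}
    (hD : ∀ f h : G.Direction, f ≠ h → ∃ c ∈ D, c.Distinguishes f h ∨ c.Distinguishes h f)
    {S : Set V} (hS : ∀ c ∈ D, (c.1 : Set V) ⊆ S)
    (hDc : D.Countable) (N : Finset V) :
    (G.directionsAvoiding S N).Countable := by
  -- `E` collects the directions whose component for `N` occurs in `D`. They are determined by that
  -- component, so there are countably many; outside `E` at most one direction remains.
  let E : Set G.Direction :=
    {f ∈ G.directionsAvoiding S N | ∃ c ∈ D, (c.2 : Set V) = f.toFun N}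
  have hE : E.Countable := by
    refine Set.MapsTo.countable_of_injOn (f := fun f : G.Direction => (f.toFun N : Set V))
      (t := (fun c : G.DirectionalChoice => (c.2 : Set V)) '' D) ?_ ?_ (hDc.image _)
    · rintro f ⟨-, c, hc, he⟩
      exact ⟨c, hc, he⟩
    · intro f hf h hh he
      exact Direction.eq_of_toFun_eq_of_disjoint hD hS hf.1.1 (ComponentCompl.coe_inj.1 he)
  have key : ∀ f ∈ G.directionsAvoiding S N \ E, ∀ h ∈ G.directionsAvoiding S N \ E, ∀ c ∈ D,
      ¬ c.Distinguishes f h := by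
    rintro f ⟨hf, hfE⟩ h ⟨hh, -⟩ c hc hd
    have hfc := f.subset_of_disjoint (Y := c.1) fun z hz hzX => hf.1 z hz (hS c hc hzX)
    have hhc := h.subset_of_disjoint (Y := c.1) fun z hz hzX => hh.1 z hz (hS c hc hzX)
    -- If `N ⊆ X`, then `f X = f N`, and `f` would be in `E`. Otherwise a vertex of `N` outside `X`
    -- is adjacent to both `f N` and `h N`, which puts them in the same component of `G - X`.
    by_cases hN : N ⊆ c.1
    · refine hfE ⟨hf, c, hc, ?_⟩
      rw [← hd.1]
      exact (f.anti hN).antisymm hfc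
    · obtain ⟨x, hxN, hxX⟩ := Finset.not_subset.1 hN
      obtain ⟨y, hy, hadj⟩ := hf.2 x hxN
      obtain ⟨y', hy', hadj'⟩ := hh.2 x hxN
      refine hd.2 (Eq.trans (ComponentCompl.eq_of_mem (v := x) ?_ ?_) hd.1)
      · exact ComponentCompl.mem_of_adj _ _ (hhc hy') (by simpa using hxX) hadj'
      · exact ComponentCompl.mem_of_adj _ _ (hfc hy) (by simpa using hxX) hadj
  have hsub : (G.directionsAvoiding S N \ E).Subsingleton := by
    intro f hf h hh
    by_contra hne
    obtain ⟨c, hc, hd | hd⟩ := hD f h hne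
    · exact key f hf h hh c hc hd
    · exact key h hh f hf c hc hd
  refine (hE.union hsub.countable).mono fun f hf => ?_
  by_cases hfE : f ∈ E
  · exact Or.inl hfE
  · exact Or.inr ⟨hf, hfE⟩

theorem Subgraph.IsNormalTree.exists_ray_direction_eq {D : Set G.DirectionalChoice}
    (hD : ∀ f h : G.Direction, f ≠ h → ∃ c ∈ D, c.Distinguishes f h ∨ c.Distinguishes h f)
    {S : Set V} (hS : ∀ c ∈ D, (c.1 : Set V) ⊆ S)
    {T : G.Subgraph} {r : T.verts}
    (hT : T.IsNormalTree r) (hST : S ⊆ T.verts) (f : G.Direction)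
    (hf : ∀ A : Finset V, (A : Set V) ⊆ T.verts → ∃ s ∈ f.toFun A, s ∈ T.verts) :
    ∃ R : G.Ray, R.IsContainedIn T ∧ R.direction = f := by
  obtain ⟨R, hRT, hR⟩ := hT.exists_ray f hf
  exact ⟨R, hRT, Direction.eq_of_toFun_eq_of_subset hD hS fun X hX => hR X (hX.trans hST)⟩

/-- A countable vertex set that meets all components chosen by directions. -/
theorem exists_countable_forall_direction_mem {D : Set G.DirectionalChoice}
    (hD : ∀ f h : G.Direction, f ≠ h → ∃ c ∈ D, c.Distinguishes f h ∨ c.Distinguishes h f)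
    {S : Set V} (hS : ∀ c ∈ D, (c.1 : Set V) ⊆ S)
    (hG : G.Connected) (hDc : D.Countable)
    (hSc : S.Countable) : ∃ U : Set V, U.Countable ∧ S ⊆ U ∧
      ∀ (f : G.Direction) (A : Finset V), ∃ s ∈ f.toFun A, s ∈ U := by
  obtain ⟨T, r, hTc, hT, hST⟩ := hG.exists_isNormalTree_superset hSc
  have hDT : ∀ c ∈ D, (c.1 : Set V) ⊆ T.verts := fun c hc => (hS c hc).trans hST
  -- `F` contains the exceptional directions, those for which some chosen component of `G - A` with
  -- finite `A ⊆ T` misses `T`.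
  let F : Set G.Direction :=
    ⋃ N ∈ {N : Finset V | (N : Set V) ⊆ T.verts}, G.directionsAvoiding T.verts N
  have hF : F.Countable :=
    hTc.finset_subset.biUnion fun N _ => countable_directionsAvoiding hD hDT hDc N
  have hray : ∀ f : F, ∃ R : G.Ray, R.direction = f := by
    rintro ⟨f, hf⟩
    obtain ⟨N, -, hfN⟩ := Set.mem_iUnion₂.1 hf
    obtain ⟨R, hR⟩ := f.exists_ray N
    -- Any ray inside `f N` will do, because `f` is the only direction with that value at `N`.
    refine ⟨R, (Direction.eq_of_toFun_eq_of_disjoint hD hDT hfN.1 ?_).symm⟩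
    exact (R.direction_toFun_eq ⟨0, fun i _ => hR i⟩).symm
  choose R hR using hray
  have : Countable F := hF
  refine ⟨T.verts ∪ ⋃ f : F, Set.range (R f).toFun,
    hTc.union (Set.countable_iUnion fun f => Set.countable_range _),
    hST.trans Set.subset_union_left, fun f A => ?_⟩
  by_cases hfF : f ∈ F
  · obtain ⟨n, hn⟩ := (R ⟨f, hfF⟩).exists_tail_mem_direction A
    have hmem := hn n le_rfl
    rw [hR] at hmem
    exact ⟨_, hmem, Or.inr (Set.mem_iUnion_of_mem ⟨f, hfF⟩ ⟨n, rfl⟩)⟩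
  · obtain ⟨R', hR'T, rfl⟩ := hT.exists_ray_direction_eq hD hS hST f (by
      intro A hA
      by_contra! hcon
      obtain ⟨N, hNA, hN⟩ := f.exists_mem_directionsAvoiding hcon
      exact hfF (Set.mem_biUnion (fun x hx => hA (hNA hx)) hN))
    obtain ⟨n, hn⟩ := R'.exists_tail_mem_direction A
    exact ⟨_, hn n le_rfl, Or.inl (hR'T n).fst_mem⟩

theorem IsWeaklyCountablyDetermined.exists_isNormalTree (hG : G.Connected)
    (h : G.IsWeaklyCountablyDetermined) :
    ∃ (T : G.Subgraph) (r : T.verts), T.verts.Countable ∧ T.IsNormalTree r ∧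
      ∀ ω : G.RayEnd, ∃ R : G.Ray, R.IsContainedIn T ∧ R.toEnd = ω := by
  obtain ⟨D, hDc, hD⟩ := h
  have hS : ∀ c ∈ D, (c.1 : Set V) ⊆ ⋃ c ∈ D, (c.1 : Set V) := fun c hc =>
    Set.subset_biUnion_of_mem (u := fun c : G.DirectionalChoice => (c.1 : Set V)) hc
  obtain ⟨U, hUc, hSU, hU⟩ := exists_countable_forall_direction_mem hD hS hG hDc
    (hDc.biUnion fun c _ => c.1.countable_toSet)
  obtain ⟨T, r, hTc, hT, hUT⟩ := hG.exists_isNormalTree_superset hUc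
  refine ⟨T, r, hTc, hT, fun ω => ?_⟩
  obtain ⟨R₀, rfl⟩ := Quotient.exists_rep ω
  obtain ⟨R, hRT, hR⟩ := hT.exists_ray_direction_eq hD hS (hSU.trans hUT) R₀.direction
    fun A _ => (hU R₀.direction A).imp fun s hs => ⟨hs.1, hUT hs.2⟩
  exact ⟨R, hRT, Ray.toEnd_eq_of_direction_eq hR⟩

theorem IsCountablyDetermined.isWeaklyCountablyDetermined (h : G.IsCountablyDetermined) :
    G.IsWeaklyCountablyDetermined := by
  obtain ⟨D, hDc, hD⟩ := h
  exact ⟨D, hDc, fun f h hne => (hD f h hne).imp fun c hc => ⟨hc.1, Or.inl hc.2⟩⟩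

end SimpleGraph

theorem theorem3 {V : Type*} (G : SimpleGraph V) (hG : G.Connected) :
    List.TFAE [
      G.IsCountablyDetermined,
      G.IsWeaklyCountablyDetermined,
      ∃ (T : G.Subgraph) (r : T.verts), T.verts.Countable ∧ T.IsNormalTree r ∧
        ∀ ω : G.RayEnd, ∃ R : G.Ray, R.IsContainedIn T ∧ R.toEnd = ω] := by
  tfae_have 1 → 2 := fun h => h.isWeaklyCountablyDetermined
  tfae_have 2 → 3 := fun h => h.exists_isNormalTree hG
  tfae_have 3 → 1 := fun ⟨_, _, hc, hT, hends⟩ => hT.isCountablyDetermined hc hends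
  tfae_finish
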